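/- For $d\ge 1$ and $C\subset\mathbb R^d$, a packing by $C$ is a countable family $\mathscr C=\{C_i\}_{i\in I}$ of images of $C$ under isometries of $\mathbb R^d$ with mutually disjoint interiors. Its upper density is $$\delta^+(\mathscr C)=\limsup_{r\to\infty}\frac{\mathrm{Vol}\big(\bigcup_i C_i\cap r\mathbb B^d\big)}{\mathrm{Vol}(r\mathbb B^d)},$$ where $\mathbb B^d$ is the open unit ball, and $\delta^+(C)$ is the supremum of $\delta^+(\mathscr C)$ over all packings by $C$. A function $f:\mathbb R^d\to[0,\infty)$ is a Blichfeldt gauge for $C$ if $\sum_{i\in I} f(\phi_i^{-1}x)\le 1$ for all $x\in\mathbb R^d$ and every countable family $\{\phi_i\}_{i\in I}$ of isometries of $\mathbb R^d$ for which $\{\phi_iC\}_{i\in I}$ is a packing. Put $J(f)=\int_{\mathbb R^d} f\,\mathrm dV$. Let $f_1$ be the modified Blichfeldt gauge: $f_1(r)=1$ for $0\le r\le 2-\sqrt2$, $f_1(r)=\frac12(2-r)^2$ for $2-\sqrt2\le r\le 1$, $f_1(r)=\frac12(2-r^2)$ for $1\le r\le\sqrt2$, and $f_1(r)=0$ for $r>\sqrt2$.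 With $\mathbb D^d$ the closed unit ball, let $A_2=\frac{1}{\mathrm{Vol}(\mathbb D^2)}\int_{\mathbb R^2} f_1(|x|)\,\mathrm dV$. For an integer $n\ge 0$ and real $t>0$, let $C(t)=\mathbb D^{n+2}+t\mathbb I^n\subset\mathbb R^{n+2}$ (Minkowski sum), where $t\mathbb I^n=\{(0,0)\}\times[0,t]^n$. Let $C(t)_{-1}$ be the set of points $x$ whose closed unit ball lies in $C(t)$, and let $g_t(x)=f_1(d(x,C(t)_{-1}))$. Then the following hold. 1. $A_2=\dfrac{29-16\sqrt2}{6}$ and $\dfrac1{A_2}=\dfrac{6}{29-16\sqrt2}=0.941533\ldots$ 2. For every $n\ge 0$ and $t>0$, $g_t$ is an integrable Blichfeldt gauge for $C(t)$, $J(g_t)>0$, and $\delta^+(C(t))\le \mathrm{Vol}(C(t))/J(g_t)$. 3. For every $n\ge0$, as $t\to\infty$, $$J(g_t)=\pi A_2t^n+O(t^{n-1})\qquad\text{and}\qquad \delta^+(C(t))\le\frac{\pi t^n}{\pi A_2t^n+O(t^{n-1})}.$$ Here the two $O(t^{n-1})$ terms need not be the same function and their constants may depend on $n$; in the second formula the error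 term can be chosen so that, for every $t>0$, the denominator is positive and the inequality holds. 4. For every $n\ge 0$, packings of $\mathbb R^{n+2}$ by polycylinders (sets congruent to $\mathbb D^2\times\mathbb R^n$) satisfy $$\delta^+(\mathbb D^2\times\mathbb R^n)\le\frac1{A_2}=\frac{6}{29-16\sqrt2}=0.941533\ldots$$ -/

import Mathlib

open MeasureTheory Filter Set
open scoped Pointwise ENNReal

noncomputable section

/-- Euclidean space of dimension `d`. -/
abbrev Euc (d : ℕ) : Type := EuclideanSpace ℝ (Fin d)

/-- The family `S` is a packing by congruent copies of `C`: every member is the image of `C` under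
an isometry of the ambient space, and the members have mutually disjoint interiors. -/
def IsPackingBy {d : ℕ} (C : Set (Euc d)) {ι : Type} (S : ι → Set (Euc d)) : Prop :=
  (∀ i, ∃ φ : Euc d ≃ᵢ Euc d, S i = φ '' C) ∧
    Pairwise (fun i j => Disjoint (interior (S i)) (interior (S j)))

/-- The upper density of a family of sets, measured in large balls about the origin. -/
def upperDensity {d : ℕ} {ι : Type} (S : ι → Set (Euc d)) : ℝ≥0∞ :=
  limsup (fun r : ℝ =>
    volume ((⋃ i, S i) ∩ Metric.ball 0 r) / volume (Metric.ball (0 : Euc d) r)) atTop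

/-- The upper packing density of `C`: the supremum of the upper densities of all countable packings
by congruent copies of `C`. -/
def upperPackingDensity {d : ℕ} (C : Set (Euc d)) : ℝ≥0∞ :=
  ⨆ (ι : Type) (_ : Countable ι) (S : ι → Set (Euc d)) (_ : IsPackingBy C S), upperDensity S

/-- A nonnegative function `f` is a Blichfeldt gauge for `C` if, for every countable family of
isometries `φ i` moving `C` into a packing, `∑ i, f ((φ i)⁻¹ x) ≤ 1` at every point `x`. The sum of
nonnegative terms is taken in `[0, ∞]`. -/
def IsBlichfeldtGauge {d : ℕ} (C : Set (Euc d)) (f : Euc d → ℝ) : Prop :=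
  (∀ x, 0 ≤ f x) ∧
    ∀ (ι : Type) (_ : Countable ι) (φ : ι → (Euc d ≃ᵢ Euc d)),
      IsPackingBy C (fun i => φ i '' C) →
        ∀ x, ∑' i, ENNReal.ofReal (f ((φ i).symm x)) ≤ 1

/-- The total mass `J(g)` of a gauge. -/
def gaugeMass {d : ℕ} (g : Euc d → ℝ) : ℝ := ∫ x, g x

/-- Blichfeldt's modified gauge, as a function of the radius `r ≥ 0`. -/
def modifiedGauge (r : ℝ) : ℝ :=
  if r ≤ 2 - √2 then 1
  else if r ≤ 1 then (2 - r) ^ 2 / 2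
  else if r ≤ √2 then (2 - r ^ 2) / 2
  else 0

/-- `A₂ = J(f₁) / Vol(𝔻²)`, with `f₁` the modified gauge seen as a radial function on the plane. -/
def blichfeldtA2 : ℝ :=
  gaugeMass (fun x : Euc 2 => modifiedGauge ‖x‖) / volume.real (Metric.closedBall (0 : Euc 2) 1)

/-- The standard polycylinder `𝔻² × ℝⁿ` in `ℝⁿ⁺²`; the disk lies in the first two coordinates. -/
def polycylinder (n : ℕ) : Set (Euc (n + 2)) :=
  {x | x 0 ^ 2 + x 1 ^ 2 ≤ 1}

/-- The cube `t 𝕀ⁿ = {0} × [0, t]ⁿ` in `ℝⁿ⁺²`; its first two coordinates vanish. -/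
def cubeIn (n : ℕ) (t : ℝ) : Set (Euc (n + 2)) :=
  {x | x 0 = 0 ∧ x 1 = 0 ∧ ∀ i : Fin n, x i.succ.succ ∈ Icc 0 t}

/-- The capped body `𝔻ⁿ⁺² + t 𝕀ⁿ` (Minkowski sum). -/
def cappedBody (n : ℕ) (t : ℝ) : Set (Euc (n + 2)) :=
  Metric.closedBall 0 1 + cubeIn n t

/-- The inner parallel body of `C` at distance `ρ`. -/
def innerParallelBody {d : ℕ} (C : Set (Euc d)) (ρ : ℝ) : Set (Euc d) :=
  {x | Metric.closedBall x ρ ⊆ C}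

/-- The gauge `x ↦ f₁(d(x, C(t)₋₁))` of the capped body `C(t)`. -/
def cappedGauge (n : ℕ) (t : ℝ) (x : Euc (n + 2)) : ℝ :=
  modifiedGauge (Metric.infDist x (innerParallelBody (cappedBody n t) 1))

end

/-!
The whole argument rests on one inequality for points of a Euclidean space: if points `pᵢ` are at
mutual distance at least `2`, then `∑ f₁(‖pᵢ‖) ≤ 1` (`sum_modifiedGauge_norm_le_one`). Points
outside the ball of radius `√2` do not contribute, and at most one point `a` lies inside the unit
ball. If there is none, `f₁(r) = (2 - r²) / 2` at all of them, and expanding `0 ≤ ‖∑ pᵢ‖²` with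
`2⟨pᵢ, pⱼ⟩ ≤ ‖pᵢ‖² + ‖pⱼ‖² - 4` gives Blichfeldt's inequality (`sum_two_sub_sq_le`). If `‖a‖ = r`
is below `1`, the same expansion of `0 ≤ ‖(2 - r) a + r ∑ pᵢ‖²` gives the larger value
`(2 - r)² / 2` at `a` (`sq_add_sum_two_sub_sq_le`).

If every unit ball centred at a closed core `K` lies in `C`, then the cores of the members of a
packing by `C` are at mutual distance at least `2`, so `x ↦ f₁(d(x, K))` is a gauge for `C`
(`isBlichfeldtGauge_modifiedGauge_infDist`): apply the inequality to the nearest points of the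
cores. Convexity plays no role. For the capped body the core is the cube `t 𝕀ⁿ`, which is its inner
parallel body (`innerParallelBody_cappedBody`); for the polycylinder it is the axis.

The density bounds follow from `upperPackingDensity_le_of_gauge`, which asks only that the part of
`C` in a ball have volume at most `κ` times the mass of the gauge in a slightly larger ball. For a
bounded body, `κ` is the volume divided by the mass. For the polycylinder, `κ = 1 / A₂` works slice
by slice (`volume_polycylinder_inter_ball_le`), so that no limit `t → ∞` is needed.

The volume of the capped body and the mass of its gauge are both integrals of a function of the
distance to the cube. Over the cube this distance is the planar norm, which gives the main terms
`π tⁿ` and `π A₂ tⁿ`; the rest is at most the volume over the difference of two concentric cubes of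
sides `t + 4` and `t` (`integral_comp_infDist_bounds`), which is `O(tⁿ⁻¹)`.
-/

open MeasureTheory Filter Set
open scoped Pointwise ENNReal

/-! ### The modified gauge as a function of the radius -/

lemma modifiedGauge_nonneg (r : ℝ) : 0 ≤ modifiedGauge r := by
  unfold modifiedGauge
  split_ifs with h1 h2 h3
  · exact zero_le_one
  · positivity
  · have : r ^ 2 ≤ √2 ^ 2 := by gcongr; linarith
    rw [Real.sq_sqrt (by norm_num)] at this
    linarith
  · exact le_rfl

lemma modifiedGauge_le_one (r : ℝ) : modifiedGauge r ≤ 1 := by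
  have hs : √2 ^ 2 = 2 := Real.sq_sqrt (by norm_num)
  unfold modifiedGauge
  split_ifs with h1 h2 h3
  · exact le_rfl
  · nlinarith [Real.sqrt_nonneg 2]
  · nlinarith
  · exact zero_le_one

lemma modifiedGauge_eq_zero {r : ℝ} (hr : √2 ≤ r) : modifiedGauge r = 0 := by
  have hs : √2 ^ 2 = 2 := Real.sq_sqrt (by norm_num)
  have h1 : 1 < √2 := by rw [Real.lt_sqrt] <;> norm_num
  unfold modifiedGauge
  rw [if_neg (by linarith), if_neg (by linarith)]
  split_ifs with h
  · rw [le_antisymm h hr, hs]; norm_num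
  · rfl

lemma modifiedGauge_of_one_le {r : ℝ} (h1 : 1 ≤ r) (h2 : r ≤ √2) :
    modifiedGauge r = (2 - r ^ 2) / 2 := by
  have h3 : 1 < √2 := by rw [Real.lt_sqrt] <;> norm_num
  unfold modifiedGauge
  rw [if_neg (by linarith)]
  split_ifs with h
  · rw [le_antisymm h h1]; norm_num
  · rfl

lemma measurable_modifiedGauge : Measurable modifiedGauge := by
  unfold modifiedGauge
  refine Measurable.ite measurableSet_Iic measurable_const
    (Measurable.ite measurableSet_Iic (by fun_prop)
      (Measurable.ite measurableSet_Iic (by fun_prop) measurable_const))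

/-! ### The inequality for points at mutual distance at least two -/

section Points

variable {E : Type*} [NormedAddCommGroup E] [InnerProductSpace ℝ E]

lemma inner_le_of_two_le_dist {a b : E} (h : 2 ≤ dist a b) :
    2 * inner ℝ a b ≤ ‖a‖ ^ 2 + ‖b‖ ^ 2 - 4 := by
  have := norm_sub_sq_real a b
  rw [dist_eq_norm] at h
  nlinarith

/-- The pairwise distances bound the off-diagonal inner products in the expansion of the squared
norm of the sum. -/
lemma norm_sum_sq_le {ι : Type*} (s : Finset ι) (p : ι → E)
    (hp : (s : Set ι).Pairwise fun i j => 2 ≤ dist (p i) (p j)) :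
    ‖∑ i ∈ s, p i‖ ^ 2 ≤ s.card * ∑ i ∈ s, ‖p i‖ ^ 2 - 2 * (s.card : ℝ) ^ 2 + 2 * s.card := by
  classical
  have h1 : ‖∑ i ∈ s, p i‖ ^ 2 = ∑ i ∈ s, ∑ j ∈ s, inner ℝ (p i) (p j) := by
    rw [← real_inner_self_eq_norm_sq, sum_inner]
    simp_rw [inner_sum]
  have h2 : ∀ i ∈ s, ∀ j ∈ s, inner ℝ (p i) (p j) ≤
      (‖p i‖ ^ 2 / 2 + ‖p j‖ ^ 2 / 2 - 2) + if i = j then 2 else 0 := by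
    intro i hi j hj
    split_ifs with hij
    · subst hij
      rw [real_inner_self_eq_norm_sq]
      linarith
    · linarith [inner_le_of_two_le_dist (hp hi hj hij)]
  rw [h1]
  refine (Finset.sum_le_sum fun i hi => Finset.sum_le_sum fun j hj => h2 i hi j hj).trans_eq ?_
  have h3 : ∀ i ∈ s, ∑ j ∈ s, (if i = j then (2 : ℝ) else 0) = 2 := fun i hi => by simp [hi]
  simp_rw [Finset.sum_add_distrib, Finset.sum_sub_distrib, Finset.sum_add_distrib]
  rw [Finset.sum_congr rfl h3]
  simp only [Finset.sum_const, nsmul_eq_mul, ← Finset.mul_sum, ← Finset.sum_div]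
  ring

/-- The unmodified inequality, for points outside the unit ball. -/
lemma sum_two_sub_sq_le {ι : Type*} (s : Finset ι) (p : ι → E)
    (hp : (s : Set ι).Pairwise fun i j => 2 ≤ dist (p i) (p j)) :
    ∑ i ∈ s, (2 - ‖p i‖ ^ 2) / 2 ≤ 1 := by
  rcases s.eq_empty_or_nonempty with rfl | hs
  · simp
  have h := (sq_nonneg _).trans (norm_sum_sq_le s p hp)
  have hk : (0 : ℝ) < s.card := by exact_mod_cast hs.card_pos
  rw [← Finset.sum_div, Finset.sum_sub_distrib, Finset.sum_const, nsmul_eq_mul]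
  have : 0 ≤ (s.card : ℝ) * (∑ i ∈ s, ‖p i‖ ^ 2 - 2 * s.card + 2) := by nlinarith
  have := nonneg_of_mul_nonneg_right this hk
  linarith

/-- The inequality behind the middle piece of the gauge, for one point `a` inside the unit ball. -/
lemma sq_add_sum_two_sub_sq_le {ι : Type*} (s : Finset ι) (p : ι → E) (hs : s.Nonempty)
    (hp : (s : Set ι).Pairwise fun i j => 2 ≤ dist (p i) (p j)) (a : E) (ha0 : 0 < ‖a‖)
    (ha1 : ‖a‖ ≤ 1) (ha : ∀ i ∈ s, 2 ≤ dist a (p i)) :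
    (2 - ‖a‖) ^ 2 / 2 + ∑ i ∈ s, (2 - ‖p i‖ ^ 2) / 2 ≤ 1 := by
  set r := ‖a‖ with hr
  set P := ∑ i ∈ s, p i
  set Q := ∑ i ∈ s, ‖p i‖ ^ 2
  have hk : (1 : ℝ) ≤ s.card := by exact_mod_cast hs.card_pos
  set k := (s.card : ℝ)
  have h1 : ‖P‖ ^ 2 ≤ k * Q - 2 * k ^ 2 + 2 * k := norm_sum_sq_le s p hp
  have h2 : 2 * inner ℝ a P ≤ k * r ^ 2 + Q - 4 * k := by
    rw [inner_sum, Finset.mul_sum]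
    refine (Finset.sum_le_sum fun i hi => inner_le_of_two_le_dist (ha i hi)).trans_eq ?_
    rw [Finset.sum_sub_distrib, Finset.sum_add_distrib, Finset.sum_const, Finset.sum_const,
      nsmul_eq_mul, nsmul_eq_mul]
    ring
  -- the weights `2 - r` and `r` make the resulting bound sharp for a single point opposite to `a`
  have h3 : 0 ≤ (2 - r) ^ 2 * r ^ 2 + (2 - r) * r * (2 * inner ℝ a P) + r ^ 2 * ‖P‖ ^ 2 := by
    have := sq_nonneg ‖(2 - r) • a + r • P‖
    rw [norm_add_sq_real, norm_smul, norm_smul, inner_smul_left, inner_smul_right, mul_pow,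
      mul_pow, Real.norm_eq_abs, Real.norm_eq_abs, sq_abs, sq_abs, ← hr] at this
    simp only [conj_trivial] at this
    linarith
  have h4 : (2 - r) * r * (2 * inner ℝ a P) ≤ (2 - r) * r * (k * r ^ 2 + Q - 4 * k) :=
    mul_le_mul_of_nonneg_left h2 (mul_nonneg (by linarith) ha0.le)
  have h5 : r ^ 2 * ‖P‖ ^ 2 ≤ r ^ 2 * (k * Q - 2 * k ^ 2 + 2 * k) :=
    mul_le_mul_of_nonneg_left h1 (sq_nonneg r)
  -- the slack that is left when there are several points besides `a`
  have h6 : 0 ≤ (k - 1) * ((1 - r) * (2 - r)) :=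
    mul_nonneg (by linarith) (mul_nonneg (by linarith) (by linarith))
  have h7 : 0 ≤ (r * (2 - r + r * k)) * (Q - (2 * k - 2 + (2 - r) ^ 2)) := by
    nlinarith [mul_nonneg ha0.le h6]
  have h8 := nonneg_of_mul_nonneg_right h7 (by nlinarith [mul_pos ha0 (by linarith : 0 < k)])
  rw [← Finset.sum_div, Finset.sum_sub_distrib, Finset.sum_const, nsmul_eq_mul]
  linarith

/-- Points at mutual distance at least `2` have total modified gauge at most `1` about the
origin. -/
lemma sum_modifiedGauge_norm_le_one {ι : Type*} (s : Finset ι) (p : ι → E)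
    (hp : (s : Set ι).Pairwise fun i j => 2 ≤ dist (p i) (p j)) :
    ∑ i ∈ s, modifiedGauge ‖p i‖ ≤ 1 := by
  classical
  set T := s.filter fun i => ‖p i‖ < √2 with hT
  have hsum : ∑ i ∈ s, modifiedGauge ‖p i‖ = ∑ i ∈ T, modifiedGauge ‖p i‖ := by
    rw [hT, Finset.sum_filter]
    refine Finset.sum_congr rfl fun i _ => ?_
    split_ifs with h
    · rfl
    · exact modifiedGauge_eq_zero (not_lt.1 h)
  have hTs : T ⊆ s := Finset.filter_subset _ _
  have hpT : (T : Set ι).Pairwise fun i j => 2 ≤ dist (p i) (p j) :=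
    hp.mono (by exact_mod_cast hTs)
  have hlt : ∀ i ∈ T, ‖p i‖ < √2 := fun i hi => (Finset.mem_filter.1 hi).2
  rw [hsum]
  by_cases hex : ∃ a ∈ T, ‖p a‖ < 1
  · obtain ⟨a, haT, ha1⟩ := hex
    have hd : ∀ i ∈ T.erase a, 2 ≤ dist (p a) (p i) := fun i hi =>
      hpT haT (Finset.mem_of_mem_erase hi) (Finset.ne_of_mem_erase hi).symm
    have hfar : ∀ i ∈ T.erase a, 2 - ‖p a‖ ≤ ‖p i‖ := fun i hi => by
      linarith [hd i hi, dist_le_norm_add_norm (p a) (p i)]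
    rw [← Finset.add_sum_erase T _ haT]
    rcases (T.erase a).eq_empty_or_nonempty with he | hne
    · rw [he, Finset.sum_empty, add_zero]
      exact modifiedGauge_le_one _
    have ha2 : 2 - √2 < ‖p a‖ := by
      obtain ⟨i, hi⟩ := hne
      linarith [hfar i hi, hlt i (Finset.mem_of_mem_erase hi)]
    have h2 : √2 < 2 := by rw [Real.sqrt_lt'] <;> norm_num
    have hmid : modifiedGauge ‖p a‖ = (2 - ‖p a‖) ^ 2 / 2 := by
      unfold modifiedGauge
      rw [if_neg (by linarith), if_pos ha1.le]
    rw [hmid, Finset.sum_congr rfl fun i hi => modifiedGauge_of_one_le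
      (by linarith [hfar i hi]) (hlt i (Finset.mem_of_mem_erase hi)).le]
    exact sq_add_sum_two_sub_sq_le _ p hne
      (hpT.mono (by exact_mod_cast Finset.erase_subset _ _)) (p a) (by linarith) ha1.le hd
  · push Not at hex
    rw [Finset.sum_congr rfl fun i hi => modifiedGauge_of_one_le (hex i hi) (hlt i hi).le]
    exact sum_two_sub_sq_le T p hpT

end Points

/-! ### The gauge of a body with a core -/

/-- Two points of distinct cores are at distance at least `2`, since otherwise the midpoint is an
interior point of both bodies. The nearest points to `x` in the cores therefore satisfy the
inequality for points. -/
lemma isBlichfeldtGauge_modifiedGauge_infDist {d : ℕ} {C K : Set (Euc d)} (hK : IsClosed K)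
    (hne : K.Nonempty) (hKC : ∀ p ∈ K, Metric.ball p 1 ⊆ C) :
    IsBlichfeldtGauge C fun x => modifiedGauge (Metric.infDist x K) := by
  refine ⟨fun x => modifiedGauge_nonneg _, fun ι _ φ hφ x => ?_⟩
  choose q hqK hq using fun i => hK.exists_infDist_eq_dist hne ((φ i).symm x)
  have hball : ∀ i, Metric.ball (φ i (q i)) 1 ⊆ interior (φ i '' C) := fun i => by
    refine interior_maximal ?_ Metric.isOpen_ball
    rw [← (φ i).image_ball]
    exact image_mono (hKC _ (hqK i))
  have hdist : Pairwise fun i j => 2 ≤ dist (φ i (q i) - x) (φ j (q j) - x) := by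
    intro i j hij
    rw [dist_sub_right]
    by_contra! hlt
    have hmem : ∀ k, dist (midpoint ℝ (φ i (q i)) (φ j (q j))) (φ k (q k)) < 1 →
        midpoint ℝ (φ i (q i)) (φ j (q j)) ∈ interior (φ k '' C) := fun k hk => hball k hk
    refine Set.disjoint_left.1 (hφ.2 hij) (hmem i ?_) (hmem j ?_)
    · rw [dist_midpoint_left]
      norm_num
      linarith
    · rw [dist_midpoint_right]
      norm_num
      linarith
  rw [ENNReal.tsum_eq_iSup_sum]
  refine iSup_le fun s => ?_
  rw [← ENNReal.ofReal_sum_of_nonneg fun i _ => modifiedGauge_nonneg _, ← ENNReal.ofReal_one]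
  refine ENNReal.ofReal_le_ofReal ?_
  refine le_trans (Finset.sum_le_sum fun i _ => ?_)
    (sum_modifiedGauge_norm_le_one s (fun i => φ i (q i) - x) fun i _ j _ hij => hdist hij)
  rw [hq, ← dist_eq_norm, dist_comm, ← (φ i).dist_eq, (φ i).apply_symm_apply, dist_comm]

/-! ### From gauges to density bounds -/

lemma isometryEquiv_measurePreserving {d : ℕ} (φ : Euc d ≃ᵢ Euc d) :
    MeasurePreserving φ volume volume := by
  rw [← EuclideanSpace.euclideanHausdorffMeasure_eq_volume]
  exact φ.measurePreserving_euclideanHausdorffMeasure d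

lemma tendsto_volume_ball_add_div {d : ℕ} (R : ℝ) :
    Tendsto (fun r : ℝ => volume (Metric.ball (0 : Euc d) (r + R)) /
      volume (Metric.ball (0 : Euc d) r)) atTop (nhds 1) := by
  have h1 : Tendsto (fun r : ℝ => ENNReal.ofReal (((r + R) / r) ^ d)) atTop (nhds 1) := by
    have h : Tendsto (fun r : ℝ => ((1 + R * r⁻¹) ^ d)) atTop (nhds ((1 + R * 0) ^ d)) :=
      ((tendsto_inv_atTop_zero.const_mul R).const_add 1).pow d
    rw [mul_zero, add_zero, one_pow] at h
    rw [← ENNReal.ofReal_one]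
    refine (ENNReal.tendsto_ofReal h).congr' ?_
    filter_upwards [eventually_gt_atTop 0] with r hr
    congr 2
    field_simp
  refine h1.congr' ?_
  filter_upwards [eventually_gt_atTop 0, eventually_gt_atTop (-R)] with r hr hr'
  have hB0 : volume (Metric.ball (0 : Euc d) 1) ≠ 0 :=
    (Metric.measure_ball_pos _ _ one_pos).ne'
  have hBt : volume (Metric.ball (0 : Euc d) 1) ≠ ∞ := measure_ball_lt_top.ne
  rw [Measure.addHaar_ball_of_pos _ _ hr, Measure.addHaar_ball_of_pos _ _ (by linarith : 0 < r + R),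
    finrank_euclideanSpace_fin, ENNReal.mul_div_mul_right _ _ hB0 hBt, div_pow,
    ENNReal.ofReal_div_of_pos (by positivity)]

/-- The gauge method, in a local form that applies to unbounded bodies as well: a body whose part
in each ball has volume at most `κ` times the mass of the gauge in an enlarged ball has upper
packing density at most `κ`. Adding over the packing and exchanging sum and integral bounds the
volume covered in a ball by `κ` times the volume of the enlarged ball. -/
lemma upperPackingDensity_le_of_gauge {d : ℕ} {C : Set (Euc d)} {f : Euc d → ℝ}
    (hf : IsBlichfeldtGauge C f) (hfm : Measurable f) {κ : ℝ≥0∞} (hκ : κ ≠ ∞) (R : ℝ)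
    (h : ∀ (c : Euc d) (r : ℝ), volume (C ∩ Metric.ball c r) ≤
      κ * ∫⁻ x in Metric.ball c (r + R), ENNReal.ofReal (f x)) :
    upperPackingDensity C ≤ κ := by
  refine iSup_le fun ι => iSup_le fun hι => iSup_le fun S => iSup_le fun hS => ?_
  choose φ hφ using hS.1
  obtain rfl : S = fun i => φ i '' C := funext hφ
  have key : ∀ r : ℝ, volume ((⋃ i, φ i '' C) ∩ Metric.ball 0 r) ≤
      κ * volume (Metric.ball (0 : Euc d) (r + R)) := by
    intro r
    have hpiece : ∀ i, volume (φ i '' C ∩ Metric.ball 0 r) ≤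
        κ * ∫⁻ x in Metric.ball 0 (r + R), ENNReal.ofReal (f ((φ i).symm x)) := by
      intro i
      have hpre : ∀ s, (φ i).symm ⁻¹' Metric.ball ((φ i).symm 0) s = Metric.ball 0 s := fun s => by
        rw [IsometryEquiv.preimage_ball, IsometryEquiv.symm_symm, IsometryEquiv.apply_symm_apply]
      have hemb : MeasurableEmbedding (φ i).symm := (φ i).symm.toHomeomorph.measurableEmbedding
      have hmp := isometryEquiv_measurePreserving (φ i).symm
      rw [← hpre r, ← hpre (r + R), hmp.setLIntegral_comp_preimage_emb hemb
        (fun x => ENNReal.ofReal (f x)),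
        show φ i '' C = (φ i).symm ⁻¹' C from (φ i).toEquiv.image_eq_preimage_symm C,
        ← preimage_inter, hmp.measure_preimage_emb hemb]
      exact h _ r
    calc volume ((⋃ i, φ i '' C) ∩ Metric.ball 0 r)
        ≤ ∑' i, volume (φ i '' C ∩ Metric.ball 0 r) := by
          rw [iUnion_inter]
          exact measure_iUnion_le _
      _ ≤ ∑' i, κ * ∫⁻ x in Metric.ball 0 (r + R), ENNReal.ofReal (f ((φ i).symm x)) :=
          ENNReal.tsum_le_tsum hpiece
      _ = κ * ∫⁻ x in Metric.ball 0 (r + R), ∑' i, ENNReal.ofReal (f ((φ i).symm x)) := by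
          rw [ENNReal.tsum_mul_left, lintegral_tsum]
          exact fun i => (hfm.comp (φ i).symm.continuous.measurable).ennreal_ofReal.aemeasurable
      _ ≤ κ * ∫⁻ _ in Metric.ball (0 : Euc d) (r + R), 1 := by
          gcongr with x
          exact hf.2 ι hι φ hS x
      _ = κ * volume (Metric.ball (0 : Euc d) (r + R)) := by simp
  have hlim : Tendsto (fun r : ℝ => κ * (volume (Metric.ball (0 : Euc d) (r + R)) /
      volume (Metric.ball (0 : Euc d) r))) atTop (nhds κ) := by
    simpa using ENNReal.Tendsto.const_mul (tendsto_volume_ball_add_div R) (Or.inr hκ)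
  unfold upperDensity
  rw [← hlim.limsup_eq]
  refine limsup_le_limsup (Eventually.of_forall fun r => ?_)
  simp only [← mul_div_assoc]
  exact ENNReal.div_le_div_right (key r) _

/-- The gauge bound for bounded bodies. -/
lemma upperPackingDensity_le_volume_div_gaugeMass {d : ℕ} {C : Set (Euc d)} {f : Euc d → ℝ}
    (hf : IsBlichfeldtGauge C f) (hfm : Measurable f) (hfi : Integrable f) (hJ : 0 < gaugeMass f)
    {ρ : ℝ} (hC : C ⊆ Metric.ball 0 ρ) (hsupp : ∀ x ∉ Metric.ball 0 ρ, f x = 0) :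
    upperPackingDensity C ≤ ENNReal.ofReal (volume.real C / gaugeMass f) := by
  have hCfin : volume C ≠ ∞ := ((measure_mono hC).trans_lt measure_ball_lt_top).ne
  refine upperPackingDensity_le_of_gauge hf hfm ENNReal.ofReal_ne_top (2 * ρ) fun c r => ?_
  rcases (C ∩ Metric.ball c r).eq_empty_or_nonempty with he | ⟨x₀, hx₀C, hx₀⟩
  · simp [he]
  -- all of the mass of the gauge lies in the enlarged ball as soon as `C` meets the ball
  have hmass : ∫⁻ x in Metric.ball c (r + 2 * ρ), ENNReal.ofReal (f x) =
      ENNReal.ofReal (gaugeMass f) := by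
    rw [gaugeMass, ofReal_integral_eq_lintegral_ofReal hfi (Eventually.of_forall hf.1)]
    refine setLIntegral_eq_of_support_subset ?_
    intro x hx
    have hxρ : x ∈ Metric.ball 0 ρ := by
      by_contra hx'
      exact hx (by simp [hsupp x hx'])
    have h1 := hC hx₀C
    rw [Metric.mem_ball] at *
    rw [dist_comm] at h1
    linarith [dist_triangle4 x 0 x₀ c]
  rw [hmass, ← ENNReal.ofReal_mul (by positivity), div_mul_cancel₀ _ hJ.ne',
    ofReal_measureReal hCfin]
  exact measure_mono inter_subset_left

/-! ### Splitting off the first two coordinates -/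

/-- The point of `ℝⁿ⁺²` whose first two coordinates are `w.1` and whose other coordinates are
`w.2`. -/
def joinCoords (n : ℕ) (w : Euc 2 × (Fin n → ℝ)) : Euc (n + 2) :=
  WithLp.toLp 2 (Fin.cons (w.1 0) (Fin.cons (w.1 1) w.2))

section Coordinates

variable {n : ℕ}

@[simp] lemma joinCoords_zero (w : Euc 2 × (Fin n → ℝ)) : joinCoords n w 0 = w.1 0 := rfl

@[simp] lemma joinCoords_one (w : Euc 2 × (Fin n → ℝ)) : joinCoords n w 1 = w.1 1 := rfl

@[simp] lemma joinCoords_succ_succ (w : Euc 2 × (Fin n → ℝ)) (i : Fin n) :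
    joinCoords n w i.succ.succ = w.2 i := rfl

lemma measurable_joinCoords : Measurable (joinCoords n) := by
  refine (PiLp.volume_preserving_toLp (Fin (n + 2))).measurable.comp
    (measurable_pi_iff.2 fun i => ?_)
  refine Fin.cases ?_ (fun i => Fin.cases ?_ (fun i => ?_) i) i <;> simp <;> fun_prop

lemma joinCoords_measurePreserving : MeasurePreserving (joinCoords n) volume volume := by
  have hm : Measurable fun w : Euc 2 × (Fin n → ℝ) =>
      (Fin.cons (w.1 0) (Fin.cons (w.1 1) w.2) : Fin (n + 2) → ℝ) :=
    (PiLp.volume_preserving_ofLp (Fin (n + 2))).measurable.comp measurable_joinCoords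
  refine (PiLp.volume_preserving_toLp (Fin (n + 2))).comp ⟨hm, (Measure.pi_eq fun s hs => ?_).symm⟩
  have hpre : (fun w : Euc 2 × (Fin n → ℝ) =>
      (Fin.cons (w.1 0) (Fin.cons (w.1 1) w.2) : Fin (n + 2) → ℝ)) ⁻¹' univ.pi s =
      (WithLp.ofLp ⁻¹' univ.pi fun i : Fin 2 => s (Fin.castLE (by omega) i)) ×ˢ
        univ.pi fun i : Fin n => s i.succ.succ := by
    ext w
    simp [Fin.forall_fin_succ, Set.mem_pi]
    tauto
  rw [Measure.map_apply hm (MeasurableSet.univ_pi hs), hpre, Measure.volume_eq_prod,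
    Measure.prod_prod, (PiLp.volume_preserving_ofLp (Fin 2)).measure_preimage
      (MeasurableSet.univ_pi fun i => hs _).nullMeasurableSet, volume_pi_pi, volume_pi_pi,
    Fin.prod_univ_two, Fin.prod_univ_succ, Fin.prod_univ_succ, mul_assoc]
  rfl

lemma norm_sq_euc_two (y : Euc 2) : ‖y‖ ^ 2 = y 0 ^ 2 + y 1 ^ 2 := by
  rw [EuclideanSpace.norm_sq_eq, Fin.sum_univ_two]
  simp

lemma dist_sq_eq (x y : Euc (n + 2)) : dist x y ^ 2 =
    (x 0 - y 0) ^ 2 + (x 1 - y 1) ^ 2 + ∑ i : Fin n, (x i.succ.succ - y i.succ.succ) ^ 2 := by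
  rw [EuclideanSpace.dist_eq, Real.sq_sqrt (Finset.sum_nonneg fun i _ => sq_nonneg _),
    Fin.sum_univ_succ, Fin.sum_univ_succ]
  simp [Real.dist_eq, add_assoc]

lemma dist_joinCoords_left (y y' : Euc 2) (z : Fin n → ℝ) :
    dist (joinCoords n (y, z)) (joinCoords n (y', z)) = dist y y' := by
  rw [← sq_eq_sq₀ dist_nonneg dist_nonneg, dist_sq_eq, dist_eq_norm y, norm_sq_euc_two]
  simp

lemma abs_sub_le_dist (x y : Euc n) (i : Fin n) : |x i - y i| ≤ dist x y := by
  have := PiLp.norm_apply_le (x - y) i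
  rwa [← dist_eq_norm] at this

end Coordinates

/-! ### Distance to the cube -/

section Cube

variable {n : ℕ} {t : ℝ}

lemma isClosed_cubeIn : IsClosed (cubeIn n t) := by
  have hc : ∀ i : Fin (n + 2), Continuous fun x : Euc (n + 2) => x i := fun i => by fun_prop
  have : cubeIn n t = {x | x 0 = 0} ∩ {x | x 1 = 0} ∩
      ⋂ i : Fin n, {x | x i.succ.succ ∈ Icc 0 t} := by
    ext x
    simp [cubeIn, and_assoc]
  rw [this]
  exact ((isClosed_eq (hc 0) continuous_const).inter (isClosed_eq (hc 1) continuous_const)).inter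
    (isClosed_iInter fun i => isClosed_Icc.preimage (hc _))

lemma zero_mem_cubeIn (ht : 0 < t) : (0 : Euc (n + 2)) ∈ cubeIn n t :=
  ⟨rfl, rfl, fun _ => ⟨le_rfl, ht.le⟩⟩

lemma mem_cappedBody_iff (ht : 0 < t) (x : Euc (n + 2)) :
    x ∈ cappedBody n t ↔ Metric.infDist x (cubeIn n t) ≤ 1 := by
  constructor
  · rintro ⟨b, hb, p, hp, rfl⟩
    refine (Metric.infDist_le_dist_of_mem hp).trans ?_
    simpa using hb
  · intro h
    obtain ⟨p, hp, hpd⟩ := (isClosed_cubeIn (n := n) (t := t)).exists_infDist_eq_dist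
      ⟨0, zero_mem_cubeIn ht⟩ x
    refine ⟨x - p, ?_, p, hp, sub_add_cancel _ _⟩
    rwa [mem_closedBall_zero_iff, ← dist_eq_norm, ← hpd]

/-- The coordinates of a point close to the cube are close to those of the cube. -/
lemma coords_of_infDist_le {x : Euc (n + 2)} {ρ : ℝ} (ht : 0 < t)
    (h : Metric.infDist x (cubeIn n t) ≤ ρ) :
    |x 0| ≤ ρ ∧ |x 1| ≤ ρ ∧ ∀ i : Fin n, x i.succ.succ ∈ Icc (-ρ) (t + ρ) := by
  obtain ⟨p, hp, hpd⟩ := (isClosed_cubeIn (n := n) (t := t)).exists_infDist_eq_dist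
      ⟨0, zero_mem_cubeIn ht⟩ x
  have hc : ∀ i, |x i - p i| ≤ ρ := fun i => (abs_sub_le_dist x p i).trans (hpd ▸ h)
  refine ⟨by simpa [hp.1] using hc 0, by simpa [hp.2.1] using hc 1, fun i => ?_⟩
  have h1 := abs_le.1 (hc i.succ.succ)
  have h2 := hp.2.2 i
  exact ⟨by linarith [h2.1], by linarith [h2.2]⟩

/-- The inner parallel body of the capped body at distance `1` is the cube itself: the translates
of a point by the coordinate unit vectors bound each of its coordinates. -/
lemma innerParallelBody_cappedBody (ht : 0 < t) :
    innerParallelBody (cappedBody n t) 1 = cubeIn n t := by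
  ext x
  constructor
  · intro hx
    have hshift : ∀ (i : Fin (n + 2)) (s : ℝ), |s| ≤ 1 →
        Metric.infDist (x + EuclideanSpace.single i s) (cubeIn n t) ≤ 1 := fun i s hs => by
      rw [← mem_cappedBody_iff ht]
      refine hx ?_
      rw [Metric.mem_closedBall, dist_eq_norm, add_sub_cancel_left]
      simpa using hs
    have hp : ∀ i, _ := fun i => coords_of_infDist_le ht (hshift i 1 (by simp))
    have hm : ∀ i, _ := fun i => coords_of_infDist_le ht (hshift i (-1) (by simp))
    refine ⟨?_, ?_, fun i => ⟨?_, ?_⟩⟩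
    · have h1 := abs_le.1 (hp 0).1
      have h2 := abs_le.1 (hm 0).1
      simp at h1 h2
      linarith
    · have h1 := abs_le.1 (hp 1).2.1
      have h2 := abs_le.1 (hm 1).2.1
      simp at h1 h2
      linarith
    · have h2 := (hm i.succ.succ).2.2 i
      simp at h2
      linarith
    · have h2 := (hp i.succ.succ).2.2 i
      simp at h2
      linarith
  · intro hx y hy
    rw [mem_cappedBody_iff ht]
    exact (Metric.infDist_le_dist_of_mem hx).trans hy

lemma cappedGauge_eq (ht : 0 < t) :
    cappedGauge n t = fun x => modifiedGauge (Metric.infDist x (cubeIn n t)) := by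
  unfold cappedGauge
  rw [innerParallelBody_cappedBody ht]

lemma norm_le_dist_joinCoords {y : Euc 2} {z : Fin n → ℝ} {p : Euc (n + 2)} (h0 : p 0 = 0)
    (h1 : p 1 = 0) : ‖y‖ ≤ dist (joinCoords n (y, z)) p := by
  rw [← sq_le_sq₀ (norm_nonneg _) dist_nonneg, dist_sq_eq, norm_sq_euc_two, h0, h1]
  simpa using Finset.sum_nonneg fun i _ => sq_nonneg _

lemma norm_le_infDist_cubeIn (ht : 0 < t) (y : Euc 2) (z : Fin n → ℝ) :
    ‖y‖ ≤ Metric.infDist (joinCoords n (y, z)) (cubeIn n t) :=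
  (Metric.le_infDist ⟨0, zero_mem_cubeIn ht⟩).2 fun _ hp => norm_le_dist_joinCoords hp.1 hp.2.1

/-- Over the cube, the distance to the cube is the distance to its affine span. -/
lemma infDist_joinCoords_cubeIn (ht : 0 < t) {z : Fin n → ℝ}
    (hz : z ∈ univ.pi fun _ => Icc (0 : ℝ) t) (y : Euc 2) :
    Metric.infDist (joinCoords n (y, z)) (cubeIn n t) = ‖y‖ := by
  have hz' : joinCoords n (0, z) ∈ cubeIn n t := ⟨by simp, by simp, fun i => hz i (mem_univ i)⟩
  refine le_antisymm ?_ (norm_le_infDist_cubeIn ht y z)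
  refine (Metric.infDist_le_dist_of_mem hz').trans_eq ?_
  rw [dist_joinCoords_left, dist_zero_right]

lemma norm_le_of_mem_cubeIn {p : Euc (n + 2)} (hp : p ∈ cubeIn n t) : ‖p‖ ≤ √(n * t ^ 2) := by
  refine Real.le_sqrt_of_sq_le ?_
  rw [← dist_zero_right, dist_sq_eq, hp.1, hp.2.1]
  have : ∀ i : Fin n, p i.succ.succ ^ 2 ≤ t ^ 2 := fun i =>
    pow_le_pow_left₀ (hp.2.2 i).1 (hp.2.2 i).2 2
  simpa using Finset.sum_le_sum fun i (_ : i ∈ Finset.univ) => this i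

lemma norm_le_of_infDist_cubeIn_le (ht : 0 < t) {x : Euc (n + 2)} {ρ : ℝ}
    (h : Metric.infDist x (cubeIn n t) ≤ ρ) : ‖x‖ ≤ √(n * t ^ 2) + ρ := by
  obtain ⟨p, hp, hpd⟩ := (isClosed_cubeIn (n := n) (t := t)).exists_infDist_eq_dist
    ⟨0, zero_mem_cubeIn ht⟩ x
  rw [hpd, dist_eq_norm] at h
  linarith [norm_le_of_mem_cubeIn hp, norm_le_norm_add_norm_sub' x p]

end Cube

/-! ### The value of the constant -/

lemma volume_real_closedBall_fin_two {r : ℝ} (hr : 0 ≤ r) :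
    volume.real (Metric.closedBall (0 : Euc 2) r) = Real.pi * r ^ 2 := by
  rw [measureReal_def, EuclideanSpace.volume_closedBall_fin_two, ENNReal.toReal_mul,
    ENNReal.toReal_pow, ENNReal.toReal_ofReal hr, ENNReal.toReal_ofReal Real.pi_pos.le, mul_comm]

open intervalIntegral in
lemma integral_mul_modifiedGauge :
    ∫ y in Ioi (0 : ℝ), y * modifiedGauge y = (29 - 16 * √2) / 12 := by
  have hs : √2 ^ 2 = 2 := Real.sq_sqrt (by norm_num)
  have hs1 : 1 < √2 := by rw [Real.lt_sqrt] <;> norm_num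
  have hs2 : √2 < 2 := by rw [Real.sqrt_lt'] <;> norm_num
  have hrestr : ∫ y in Ioi (0 : ℝ), y * modifiedGauge y =
      ∫ y in (0 : ℝ)..√2, y * modifiedGauge y := by
    rw [integral_of_le (by positivity)]
    refine setIntegral_eq_of_subset_of_forall_sdiff_eq_zero measurableSet_Ioi
      (fun y hy => hy.1) fun y hy => ?_
    rw [modifiedGauge_eq_zero, mul_zero]
    by_contra! hlt
    exact hy.2 ⟨hy.1, hlt.le⟩
  have hint : ∀ a b : ℝ, IntervalIntegrable (fun y => y * modifiedGauge y) volume a b := by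
    intro a b
    refine IntervalIntegrable.mono_fun (g := fun y : ℝ => y * modifiedGauge y)
      (f := fun y : ℝ => y) (continuous_id.intervalIntegrable _ _)
      ((measurable_id.mul measurable_modifiedGauge).aestronglyMeasurable) ?_
    refine Eventually.of_forall fun y => ?_
    simp only [norm_mul]
    rw [Real.norm_of_nonneg (modifiedGauge_nonneg y)]
    exact mul_le_of_le_one_right (norm_nonneg _) (modifiedGauge_le_one y)
  have h1 : ∫ y in (0 : ℝ)..(2 - √2), y * modifiedGauge y = (2 - √2) ^ 2 / 2 := by
    rw [integral_congr (g := fun y : ℝ => y)]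
    · rw [integral_id]; ring
    · intro y hy
      rw [uIcc_of_le (by linarith)] at hy
      simp only [modifiedGauge, if_pos hy.2, mul_one]
  have h2 : ∫ y in (2 - √2)..1, y * modifiedGauge y =
      (1 - 2 / 3 + 1 / 8) - ((2 - √2) ^ 2 - 2 * (2 - √2) ^ 3 / 3 + (2 - √2) ^ 4 / 8) := by
    rw [intervalIntegral.integral_congr_ae (g := fun y : ℝ => 2 * y - 2 * y ^ 2 + y ^ 3 / 2)]
    · rw [integral_eq_sub_of_hasDerivAt
        (f := fun y : ℝ => y ^ 2 - 2 * y ^ 3 / 3 + y ^ 4 / 8)]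
      · norm_num
      · intro y _
        exact (((hasDerivAt_pow 2 y).sub (((hasDerivAt_pow 3 y).const_mul 2).div_const 3)).add
          ((hasDerivAt_pow 4 y).div_const 8)).congr_deriv (by push_cast; ring)
      · exact Continuous.intervalIntegrable (by fun_prop) _ _
    · refine Eventually.of_forall fun y hy => ?_
      rw [uIoc_of_le (by linarith)] at hy
      simp only [modifiedGauge, if_neg (not_le.2 hy.1), if_pos hy.2]
      ring
  have h3 : ∫ y in (1 : ℝ)..√2, y * modifiedGauge y = 1 / 8 := by
    rw [integral_congr (g := fun y : ℝ => y - y ^ 3 / 2)]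
    · rw [integral_eq_sub_of_hasDerivAt (f := fun y : ℝ => y ^ 2 / 2 - y ^ 4 / 8)]
      · rw [show √2 ^ 4 = (√2 ^ 2) ^ 2 by ring, hs]; norm_num
      · intro y _
        exact (((hasDerivAt_pow 2 y).div_const 2).sub
          ((hasDerivAt_pow 4 y).div_const 8)).congr_deriv (by push_cast; ring)
      · exact Continuous.intervalIntegrable (by fun_prop) _ _
    · intro y hy
      rw [uIcc_of_le hs1.le] at hy
      simp only [modifiedGauge_of_one_le hy.1 hy.2]
      ring
  rw [hrestr, ← integral_add_adjacent_intervals (hint 0 (2 - √2)) (hint _ _),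
    ← integral_add_adjacent_intervals (hint (2 - √2) 1) (hint _ _), h1, h2, h3]
  linear_combination (-1 / 8 * (√2 ^ 2 + 2) + √2 / 3 + 1 / 2) * hs

lemma blichfeldtA2_eq : blichfeldtA2 = (29 - 16 * √2) / 6 := by
  unfold blichfeldtA2 gaugeMass
  rw [integral_fun_norm_addHaar, finrank_euclideanSpace_fin,
    ← Measure.addHaar_real_closedBall_eq_addHaar_real_ball,
    volume_real_closedBall_fin_two zero_le_one]
  simp only [Nat.add_one_sub_one, pow_one, smul_eq_mul, integral_mul_modifiedGauge, nsmul_eq_mul]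
  field_simp [Real.pi_ne_zero]
  norm_num
  ring

lemma blichfeldtA2_pos : 0 < blichfeldtA2 := by
  have : √2 < 3 / 2 := by rw [Real.sqrt_lt'] <;> norm_num
  rw [blichfeldtA2_eq]
  linarith

lemma one_div_blichfeldtA2_bounds :
    0.941533 < 1 / blichfeldtA2 ∧ 1 / blichfeldtA2 < 0.941534 := by
  have h1 : 1.41421356 < √2 := by rw [Real.lt_sqrt] <;> norm_num
  have h2 : √2 < 1.41421357 := by rw [Real.sqrt_lt'] <;> norm_num
  rw [lt_div_iff₀ blichfeldtA2_pos, div_lt_iff₀ blichfeldtA2_pos, blichfeldtA2_eq]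
  constructor <;> linarith

lemma integral_modifiedGauge_norm :
    ∫ y : Euc 2, modifiedGauge ‖y‖ = Real.pi * blichfeldtA2 := by
  rw [blichfeldtA2, gaugeMass, volume_real_closedBall_fin_two zero_le_one]
  field_simp

/-! ### Integrals of functions of the distance to the cube -/

section Mass

variable {n : ℕ} {t : ℝ} {h : ℝ → ℝ}

lemma volume_real_pi_Icc {a b : ℝ} (hab : a ≤ b) :
    volume.real (univ.pi fun _ : Fin n => Icc a b) = (b - a) ^ n := by
  rw [measureReal_def, volume_pi_pi, ENNReal.toReal_prod]
  simp only [Real.volume_Icc, ENNReal.toReal_ofReal (sub_nonneg.2 hab), Finset.prod_const,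
    Finset.card_univ, Fintype.card_fin]

lemma volume_real_closedBall_prod_pi_Icc {a b : ℝ} (hab : a ≤ b) :
    volume.real (Metric.closedBall (0 : Euc 2) 2 ×ˢ univ.pi fun _ : Fin n => Icc a b) =
      4 * Real.pi * (b - a) ^ n := by
  rw [Measure.volume_eq_prod, measureReal_prod_prod, volume_real_closedBall_fin_two zero_le_two,
    volume_real_pi_Icc hab]
  ring

lemma comp_infDist_le_indicator (h1 : ∀ r, h r ≤ 1) (h2 : ∀ r, 2 < r → h r = 0) (ht : 0 < t)
    (w : Euc 2 × (Fin n → ℝ)) : h (Metric.infDist (joinCoords n w) (cubeIn n t)) ≤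
      (Metric.closedBall (0 : Euc 2) 2 ×ˢ univ.pi fun _ : Fin n => Icc (-2) (t + 2)).indicator
        1 w := by
  by_cases hw : Metric.infDist (joinCoords n w) (cubeIn n t) ≤ 2
  · rw [indicator_of_mem]
    · exact h1 _
    · refine ⟨?_, fun i _ => (coords_of_infDist_le ht hw).2.2 i⟩
      rw [mem_closedBall_zero_iff]
      exact (norm_le_infDist_cubeIn ht w.1 w.2).trans hw
  · rw [h2 _ (not_le.1 hw)]
    exact indicator_nonneg (fun _ _ => zero_le_one) _

lemma integrable_comp_infDist_joinCoords (hm : Measurable h) (h0 : ∀ r, 0 ≤ h r)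
    (h1 : ∀ r, h r ≤ 1) (h2 : ∀ r, 2 < r → h r = 0) (ht : 0 < t) :
    Integrable fun w => h (Metric.infDist (joinCoords n w) (cubeIn n t)) := by
  refine Integrable.mono' (g := (Metric.closedBall (0 : Euc 2) 2 ×ˢ
    univ.pi fun _ : Fin n => Icc (-2) (t + 2)).indicator 1) ?_ ?_ ?_
  · refine (integrable_indicator_iff ?_).2 (integrableOn_const ?_)
    · exact Metric.isClosed_closedBall.measurableSet.prod
        (MeasurableSet.univ_pi fun _ => measurableSet_Icc)
    · exact ((isCompact_closedBall _ _).prod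
        (isCompact_univ_pi fun _ => isCompact_Icc)).measure_lt_top.ne
  · exact (hm.comp ((Metric.continuous_infDist_pt _).measurable.comp
      measurable_joinCoords)).aestronglyMeasurable
  · refine Eventually.of_forall fun w => ?_
    rw [Real.norm_of_nonneg (h0 _)]
    exact comp_infDist_le_indicator h1 h2 ht w

lemma measurable_comp_infDist (hm : Measurable h) :
    Measurable fun x => h (Metric.infDist x (cubeIn n t)) :=
  hm.comp (Metric.continuous_infDist_pt _).measurable

lemma integrable_comp_infDist (hm : Measurable h) (h0 : ∀ r, 0 ≤ h r)
    (h1 : ∀ r, h r ≤ 1) (h2 : ∀ r, 2 < r → h r = 0) (ht : 0 < t) :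
    Integrable fun x => h (Metric.infDist x (cubeIn n t)) :=
  (joinCoords_measurePreserving.integrable_comp
    (measurable_comp_infDist hm).aestronglyMeasurable).1
    (integrable_comp_infDist_joinCoords hm h0 h1 h2 ht)

/-- The integral of a function of the distance to the cube splits into the part over the cube,
a product integral, and a part supported over the difference of two concentric cubes. -/
lemma integral_comp_infDist_bounds (hm : Measurable h) (h0 : ∀ r, 0 ≤ h r)
    (h1 : ∀ r, h r ≤ 1) (h2 : ∀ r, 2 < r → h r = 0) (ht : 0 < t) :
    t ^ n * ∫ y : Euc 2, h ‖y‖ ≤ ∫ x, h (Metric.infDist x (cubeIn n t)) ∧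
    ∫ x, h (Metric.infDist x (cubeIn n t)) ≤
      t ^ n * (∫ y : Euc 2, h ‖y‖) + 4 * Real.pi * ((t + 4) ^ n - t ^ n) := by
  set G : Euc 2 × (Fin n → ℝ) → ℝ := fun w => h (Metric.infDist (joinCoords n w) (cubeIn n t))
  have hG : ∫ x, h (Metric.infDist x (cubeIn n t)) = ∫ w, G w := by
    rw [← joinCoords_measurePreserving.map_eq, integral_map measurable_joinCoords.aemeasurable
      (measurable_comp_infDist hm).aestronglyMeasurable]
  have hGi : Integrable G := integrable_comp_infDist_joinCoords hm h0 h1 h2 ht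
  set Q := univ.pi fun _ : Fin n => Icc (0 : ℝ) t
  set B : Set (Euc 2 × (Fin n → ℝ)) := univ ×ˢ Q
  have hQ : MeasurableSet Q := MeasurableSet.univ_pi fun _ => measurableSet_Icc
  have hB : MeasurableSet B := MeasurableSet.univ.prod hQ
  have hin : ∫ w in B, G w = t ^ n * ∫ y : Euc 2, h ‖y‖ := by
    rw [setIntegral_congr_fun (g := fun w => h ‖w.1‖ * (fun _ => 1) w.2) hB fun w hw => ?_]
    · rw [Measure.volume_eq_prod, setIntegral_prod_mul (fun y => h ‖y‖) (fun _ => 1),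
        setIntegral_const, volume_real_pi_Icc ht.le, setIntegral_univ, sub_zero, smul_eq_mul,
        mul_one, mul_comm]
    · simp only [G, mul_one]
      rw [← infDist_joinCoords_cubeIn ht hw.2 w.1]
  have hout0 : 0 ≤ ∫ w in Bᶜ, G w := integral_nonneg fun w => h0 _
  set D := Metric.closedBall (0 : Euc 2) 2 ×ˢ univ.pi fun _ : Fin n => Icc (-2) (t + 2)
  have hD : MeasurableSet D := Metric.isClosed_closedBall.measurableSet.prod
    (MeasurableSet.univ_pi fun _ => measurableSet_Icc)
  have hDfin : volume D ≠ ∞ := ((isCompact_closedBall _ _).prod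
    (isCompact_univ_pi fun _ => isCompact_Icc)).measure_lt_top.ne
  have hDi : Integrable (D.indicator (1 : Euc 2 × (Fin n → ℝ) → ℝ)) :=
    (integrable_indicator_iff hD).2 (integrableOn_const hDfin)
  have hout1 : ∫ w in Bᶜ, G w ≤ 4 * Real.pi * ((t + 4) ^ n - t ^ n) := by
    calc ∫ w in Bᶜ, G w ≤ ∫ w in Bᶜ, D.indicator 1 w :=
          setIntegral_mono hGi.integrableOn hDi.integrableOn
            (comp_infDist_le_indicator h1 h2 ht)
      _ = volume.real (D \ B) := by
          rw [integral_indicator_one hD, measureReal_restrict_apply hD, Set.sdiff_eq]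
      _ = volume.real D - volume.real (D ∩ B) := by
          linarith [measureReal_inter_add_sdiff (μ := volume) (s := D) hB hDfin]
      _ = 4 * Real.pi * ((t + 4) ^ n - t ^ n) := by
          have hDB : D ∩ B = Metric.closedBall (0 : Euc 2) 2 ×ˢ Q := by
            rw [prod_inter_prod, inter_univ, inter_eq_right.2]
            exact pi_mono fun _ _ => Icc_subset_Icc (by norm_num) (by linarith)
          rw [hDB, volume_real_closedBall_prod_pi_Icc (by linarith),
            volume_real_closedBall_prod_pi_Icc ht.le]
          ring
  rw [hG, ← integral_add_compl hB hGi, hin]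
  constructor <;> linarith

end Mass

/-! ### Capped bodies -/

section CappedBody

variable {n : ℕ} {t : ℝ}

lemma modifiedGauge_eq_zero_of_two_lt {r : ℝ} (hr : 2 < r) : modifiedGauge r = 0 := by
  have : √2 < 2 := by rw [Real.sqrt_lt'] <;> norm_num
  exact modifiedGauge_eq_zero (by linarith)

lemma integrable_cappedGauge (ht : 0 < t) : Integrable (cappedGauge n t) := by
  rw [cappedGauge_eq ht]
  exact integrable_comp_infDist measurable_modifiedGauge modifiedGauge_nonneg
    modifiedGauge_le_one (fun _ => modifiedGauge_eq_zero_of_two_lt) ht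

lemma gaugeMass_cappedGauge_bounds (ht : 0 < t) :
    Real.pi * blichfeldtA2 * t ^ n ≤ gaugeMass (cappedGauge n t) ∧
    gaugeMass (cappedGauge n t) ≤
      Real.pi * blichfeldtA2 * t ^ n + 4 * Real.pi * ((t + 4) ^ n - t ^ n) := by
  have := integral_comp_infDist_bounds (n := n) measurable_modifiedGauge modifiedGauge_nonneg
    modifiedGauge_le_one (fun _ => modifiedGauge_eq_zero_of_two_lt) ht
  rwa [integral_modifiedGauge_norm, mul_comm (t ^ n), ← cappedGauge_eq ht] at this

lemma gaugeMass_cappedGauge_pos (ht : 0 < t) : 0 < gaugeMass (cappedGauge n t) :=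
  (mul_pos (mul_pos Real.pi_pos blichfeldtA2_pos) (pow_pos ht n)).trans_le
    (gaugeMass_cappedGauge_bounds ht).1

lemma volume_cappedBody_bounds (ht : 0 < t) :
    Real.pi * t ^ n ≤ volume.real (cappedBody n t) ∧
    volume.real (cappedBody n t) ≤ Real.pi * t ^ n + 4 * Real.pi * ((t + 4) ^ n - t ^ n) := by
  have hb := integral_comp_infDist_bounds (n := n) (t := t) (h := (Iic 1).indicator 1)
    (measurable_one.indicator measurableSet_Iic)
    (fun r => indicator_nonneg (fun _ _ => zero_le_one) _)
    (fun r => indicator_le_self' (fun _ _ => zero_le_one) _)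
    (fun r hr => indicator_of_notMem (by simp; linarith) _) ht
  have hball : ∫ y : Euc 2, (Iic (1 : ℝ)).indicator (1 : ℝ → ℝ) ‖y‖ = Real.pi := by
    have : (fun y : Euc 2 => (Iic (1 : ℝ)).indicator (1 : ℝ → ℝ) ‖y‖) =
        (Metric.closedBall (0 : Euc 2) 1).indicator 1 := by
      ext y
      simp [indicator]
    rw [this, integral_indicator_one Metric.isClosed_closedBall.measurableSet,
      volume_real_closedBall_fin_two zero_le_one, one_pow, mul_one]
  have hbody : ∫ x, (Iic (1 : ℝ)).indicator (1 : ℝ → ℝ) (Metric.infDist x (cubeIn n t)) =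
      volume.real (cappedBody n t) := by
    have hset : cappedBody n t = {x | Metric.infDist x (cubeIn n t) ≤ 1} :=
      Set.ext (mem_cappedBody_iff ht)
    have hmeas : MeasurableSet (cappedBody n t) := by
      rw [hset]
      exact (isClosed_le (Metric.continuous_infDist_pt _) continuous_const).measurableSet
    rw [← integral_indicator_one hmeas, hset]
    rfl
  rwa [hball, hbody, mul_comm] at hb

lemma isBlichfeldtGauge_cappedGauge (ht : 0 < t) :
    IsBlichfeldtGauge (cappedBody n t) (cappedGauge n t) := by
  rw [cappedGauge_eq ht]
  refine isBlichfeldtGauge_modifiedGauge_infDist isClosed_cubeIn ⟨0, zero_mem_cubeIn ht⟩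
    fun p hp x hx => ?_
  rw [mem_cappedBody_iff ht]
  exact (Metric.infDist_le_dist_of_mem hp).trans (Metric.mem_ball.1 hx).le

lemma upperPackingDensity_cappedBody_le (ht : 0 < t) :
    upperPackingDensity (cappedBody n t) ≤
      ENNReal.ofReal (volume.real (cappedBody n t) / gaugeMass (cappedGauge n t)) := by
  refine upperPackingDensity_le_volume_div_gaugeMass (isBlichfeldtGauge_cappedGauge ht) ?_
    (integrable_cappedGauge ht) (gaugeMass_cappedGauge_pos ht) (ρ := √(n * t ^ 2) + 3)
    (fun x hx => ?_) fun x hx => ?_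
  · rw [cappedGauge_eq ht]
    exact measurable_comp_infDist measurable_modifiedGauge
  · rw [mem_ball_zero_iff]
    linarith [norm_le_of_infDist_cubeIn_le ht ((mem_cappedBody_iff ht x).1 hx)]
  · rw [cappedGauge_eq ht]
    refine modifiedGauge_eq_zero_of_two_lt ?_
    by_contra! hle
    refine hx ?_
    rw [mem_ball_zero_iff]
    linarith [norm_le_of_infDist_cubeIn_le ht hle]

lemma exists_add_four_pow_sub_pow_le (n : ℕ) :
    ∃ c : ℝ, 0 ≤ c ∧ ∀ t : ℝ, 1 ≤ t → (t + 4) ^ n - t ^ n ≤ c * t ^ ((n : ℤ) - 1) := by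
  induction n with
  | zero => exact ⟨0, le_rfl, fun t _ => by simp⟩
  | succ n ih =>
    obtain ⟨c, hc, h⟩ := ih
    refine ⟨5 * c + 4, by positivity, fun t ht => ?_⟩
    have ht0 : 0 < t := by linarith
    have hz : t * t ^ ((n : ℤ) - 1) = t ^ n := by
      rw [← zpow_natCast, mul_comm, ← zpow_add_one₀ ht0.ne', sub_add_cancel]
    rw [Nat.cast_succ, add_sub_cancel_right, zpow_natCast]
    calc (t + 4) ^ (n + 1) - t ^ (n + 1) = (t + 4) * ((t + 4) ^ n - t ^ n) + 4 * t ^ n := by ring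
      _ ≤ (5 * t) * (c * t ^ ((n : ℤ) - 1)) + 4 * t ^ n := by
          gcongr
          · exact sub_nonneg.2 (pow_le_pow_left₀ ht0.le (by linarith) n)
          · linarith
          · exact h t ht
      _ = (5 * c + 4) * t ^ n := by rw [← hz]; ring

lemma gaugeMass_cappedGauge_isBigO (n : ℕ) :
    (fun t : ℝ => gaugeMass (cappedGauge n t) - Real.pi * blichfeldtA2 * t ^ n)
      =O[atTop] fun t : ℝ => t ^ ((n : ℤ) - 1) := by
  obtain ⟨c, hc, h⟩ := exists_add_four_pow_sub_pow_le n
  refine Asymptotics.IsBigO.of_bound (4 * Real.pi * c) ?_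
  filter_upwards [eventually_ge_atTop 1] with t ht
  have ht0 : 0 < t := by linarith
  obtain ⟨h1, h2⟩ := gaugeMass_cappedGauge_bounds (n := n) ht0
  rw [Real.norm_of_nonneg (by linarith), Real.norm_of_nonneg (zpow_nonneg ht0.le _)]
  nlinarith [mul_le_mul_of_nonneg_left (h t ht) (by positivity : 0 ≤ 4 * Real.pi)]

/-- The error term is chosen so that the quotient in the bound is exactly the quotient of the
volume by the mass of the gauge. -/
lemma exists_isBigO_upperPackingDensity_cappedBody_le (n : ℕ) :
    ∃ R : ℝ → ℝ, (R =O[atTop] fun t : ℝ => t ^ ((n : ℤ) - 1)) ∧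
      ∀ t : ℝ, 0 < t → 0 < Real.pi * blichfeldtA2 * t ^ n + R t ∧
        upperPackingDensity (cappedBody n t) ≤
          ENNReal.ofReal (Real.pi * t ^ n / (Real.pi * blichfeldtA2 * t ^ n + R t)) := by
  refine ⟨fun t => Real.pi * t ^ n * gaugeMass (cappedGauge n t) / volume.real (cappedBody n t) -
    Real.pi * blichfeldtA2 * t ^ n, ?_, fun t ht => ?_⟩
  · obtain ⟨c, hc, h⟩ := exists_add_four_pow_sub_pow_le n
    refine Asymptotics.IsBigO.of_bound ((1 + blichfeldtA2) * (4 * Real.pi * c)) ?_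
    filter_upwards [eventually_ge_atTop 1] with t ht
    have ht0 : 0 < t := by linarith
    obtain ⟨h1, h2⟩ := gaugeMass_cappedGauge_bounds (n := n) ht0
    obtain ⟨h3, h4⟩ := volume_cappedBody_bounds (n := n) ht0
    have hp : 0 < Real.pi * t ^ n := by positivity
    have hA := blichfeldtA2_pos
    set J := gaugeMass (cappedGauge n t)
    set V := volume.real (cappedBody n t)
    have hV : 0 < V := hp.trans_le h3
    have hE := mul_le_mul_of_nonneg_left (h t ht) (by positivity : 0 ≤ 4 * Real.pi)
    set ε := 4 * Real.pi * c * t ^ ((n : ℤ) - 1) with hε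
    have hε0 : 0 ≤ ε := by positivity
    -- the first factor is at most `1`, and each of the two differences lies between `0` and `ε`
    have hrw : Real.pi * t ^ n * J / V - Real.pi * blichfeldtA2 * t ^ n =
        (Real.pi * t ^ n / V) *
          ((J - Real.pi * blichfeldtA2 * t ^ n) - blichfeldtA2 * (V - Real.pi * t ^ n)) := by
      field_simp
      ring
    have hJε : J - Real.pi * blichfeldtA2 * t ^ n ≤ ε := by linarith
    have hVε : blichfeldtA2 * (V - Real.pi * t ^ n) ≤ blichfeldtA2 * ε :=
      mul_le_mul_of_nonneg_left (by linarith) hA.le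
    have hV0 : 0 ≤ blichfeldtA2 * (V - Real.pi * t ^ n) := mul_nonneg hA.le (by linarith)
    have hAε : 0 ≤ blichfeldtA2 * ε := by positivity
    rw [hrw, norm_mul, Real.norm_of_nonneg (by positivity),
      Real.norm_of_nonneg (zpow_nonneg ht0.le _), mul_assoc (1 + blichfeldtA2), ← hε]
    refine (mul_le_of_le_one_left (norm_nonneg _) ((div_le_one hV).2 h3)).trans ?_
    rw [Real.norm_eq_abs, abs_le]
    constructor <;> linarith
  · have hp : 0 < Real.pi * t ^ n := by positivity
    have hJ := gaugeMass_cappedGauge_pos (n := n) ht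
    have hV := hp.trans_le (volume_cappedBody_bounds (n := n) ht).1
    simp only [add_sub_cancel]
    refine ⟨by positivity, (upperPackingDensity_cappedBody_le ht).trans_eq ?_⟩
    congr 1
    field_simp

end CappedBody

/-! ### Polycylinders -/

section Polycylinder

variable {n : ℕ}

/-- The axis `{0} × ℝⁿ` of the standard polycylinder. -/
def polycylinderAxis (n : ℕ) : Set (Euc (n + 2)) :=
  {x | x 0 = 0 ∧ x 1 = 0}

lemma isClosed_polycylinderAxis : IsClosed (polycylinderAxis n) := by
  have hc : ∀ i : Fin (n + 2), Continuous fun x : Euc (n + 2) => x i := fun i => by fun_prop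
  exact (isClosed_eq (hc 0) continuous_const).inter (isClosed_eq (hc 1) continuous_const)

lemma infDist_joinCoords_polycylinderAxis (y : Euc 2) (z : Fin n → ℝ) :
    Metric.infDist (joinCoords n (y, z)) (polycylinderAxis n) = ‖y‖ := by
  have hz : joinCoords n (0, z) ∈ polycylinderAxis n := ⟨by simp, by simp⟩
  refine le_antisymm ?_ ((Metric.le_infDist ⟨_, hz⟩).2 fun p hp =>
    norm_le_dist_joinCoords hp.1 hp.2)
  refine (Metric.infDist_le_dist_of_mem hz).trans_eq ?_
  rw [dist_joinCoords_left, dist_zero_right]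

lemma ball_subset_polycylinder {p : Euc (n + 2)} (hp : p ∈ polycylinderAxis n) :
    Metric.ball p 1 ⊆ polycylinder n := by
  intro x hx
  have h1 : dist x p ^ 2 ≤ 1 := by
    have := Metric.mem_ball.1 hx
    nlinarith [dist_nonneg (x := x) (y := p)]
  rw [dist_sq_eq, hp.1, hp.2, sub_zero, sub_zero] at h1
  have h2 : 0 ≤ ∑ i : Fin n, (x i.succ.succ - p i.succ.succ) ^ 2 :=
    Finset.sum_nonneg fun i _ => sq_nonneg _
  change x 0 ^ 2 + x 1 ^ 2 ≤ 1
  linarith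

lemma joinCoords_mem_polycylinder (y : Euc 2) (z : Fin n → ℝ) :
    joinCoords n (y, z) ∈ polycylinder n ↔ ‖y‖ ≤ 1 := by
  rw [← sq_le_one_iff₀ (norm_nonneg y), norm_sq_euc_two]
  rfl

lemma measurableSet_polycylinder : MeasurableSet (polycylinder n) := by
  have hc : Continuous fun x : Euc (n + 2) => x 0 ^ 2 + x 1 ^ 2 := by fun_prop
  exact (isClosed_le hc continuous_const).measurableSet

lemma lintegral_modifiedGauge_norm :
    ∫⁻ y : Euc 2, ENNReal.ofReal (modifiedGauge ‖y‖) = ENNReal.ofReal (Real.pi * blichfeldtA2) := by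
  rw [← integral_modifiedGauge_norm, ofReal_integral_eq_lintegral_ofReal]
  · -- a non-integrable function would have integral `0`, but the integral is known to be positive
    by_contra hi
    have := integral_undef hi
    rw [integral_modifiedGauge_norm] at this
    exact (mul_pos Real.pi_pos blichfeldtA2_pos).ne' this
  · exact Eventually.of_forall fun y => modifiedGauge_nonneg _

/-- The inequality holds on every slice orthogonal to the axis: if the slice of the polycylinder
meets the ball, then the enlarged ball contains the part of the slice where the gauge is
positive. -/
lemma volume_polycylinder_inter_ball_le (c : Euc (n + 2)) (r : ℝ) :
    volume (polycylinder n ∩ Metric.ball c r) ≤ ENNReal.ofReal (1 / blichfeldtA2) *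
      ∫⁻ x in Metric.ball c (r + 3),
        ENNReal.ofReal (modifiedGauge (Metric.infDist x (polycylinderAxis n))) := by
  have hfm : Measurable fun x : Euc (n + 2) =>
      ENNReal.ofReal (modifiedGauge (Metric.infDist x (polycylinderAxis n))) :=
    (measurable_modifiedGauge.comp (Metric.continuous_infDist_pt _).measurable).ennreal_ofReal
  have hFm := hfm.indicator (Metric.isOpen_ball (x := c) (ε := r + 3)).measurableSet
  have hPm := (measurableSet_polycylinder (n := n)).inter
    (Metric.isOpen_ball (x := c) (ε := r)).measurableSet
  rw [← lintegral_indicator Metric.isOpen_ball.measurableSet,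
    ← joinCoords_measurePreserving.lintegral_comp hFm,
    ← joinCoords_measurePreserving.measure_preimage hPm.nullMeasurableSet,
    Measure.volume_eq_prod, Measure.prod_apply_symm (measurable_joinCoords hPm),
    lintegral_prod_symm' (fun w => (Metric.ball c (r + 3)).indicator _ (joinCoords n w))
      (hFm.comp measurable_joinCoords),
    ← lintegral_const_mul' _ _ ENNReal.ofReal_ne_top]
  refine lintegral_mono fun z => ?_
  by_cases hex : ∃ y₀ : Euc 2, ‖y₀‖ ≤ 1 ∧ joinCoords n (y₀, z) ∈ Metric.ball c r
  · obtain ⟨y₀, hy₀, hy₀c⟩ := hex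
    have hslice : ∀ y : Euc 2, (Metric.ball c (r + 3)).indicator (fun x =>
        ENNReal.ofReal (modifiedGauge (Metric.infDist x (polycylinderAxis n))))
          (joinCoords n (y, z)) = ENNReal.ofReal (modifiedGauge ‖y‖) := by
      intro y
      by_cases hy : joinCoords n (y, z) ∈ Metric.ball c (r + 3)
      · rw [indicator_of_mem hy, infDist_joinCoords_polycylinderAxis]
      · rw [indicator_of_notMem hy, modifiedGauge_eq_zero_of_two_lt, ENNReal.ofReal_zero]
        by_contra! hle
        refine hy ?_
        rw [Metric.mem_ball] at hy₀c ⊢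
        have h1 := dist_triangle (joinCoords n (y, z)) (joinCoords n (y₀, z)) c
        rw [dist_joinCoords_left] at h1
        linarith [dist_le_norm_add_norm y y₀]
    simp only [hslice]
    rw [lintegral_modifiedGauge_norm, ← ENNReal.ofReal_mul (by
      have := blichfeldtA2_pos
      positivity)]
    have hval : 1 / blichfeldtA2 * (Real.pi * blichfeldtA2) = Real.pi := by
      have := blichfeldtA2_pos.ne'
      field_simp
    rw [hval]
    calc _ ≤ volume (Metric.closedBall (0 : Euc 2) 1) := by
          refine measure_mono fun y hy => ?_
          rw [mem_closedBall_zero_iff]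
          exact (joinCoords_mem_polycylinder y z).1 hy.1
      _ = ENNReal.ofReal Real.pi := by simp
  · have hempty : (fun y : Euc 2 => (y, z)) ⁻¹'
        (joinCoords n ⁻¹' (polycylinder n ∩ Metric.ball c r)) = ∅ := by
      rw [eq_empty_iff_forall_notMem]
      exact fun y hy => hex ⟨y, (joinCoords_mem_polycylinder y z).1 hy.1, hy.2⟩
    rw [hempty, measure_empty]
    exact zero_le

lemma upperPackingDensity_polycylinder_le (n : ℕ) :
    upperPackingDensity (polycylinder n) ≤ ENNReal.ofReal (1 / blichfeldtA2) :=
  upperPackingDensity_le_of_gauge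
    (isBlichfeldtGauge_modifiedGauge_infDist isClosed_polycylinderAxis ⟨0, rfl, rfl⟩
      fun _ => ball_subset_polycylinder)
    (measurable_modifiedGauge.comp (Metric.continuous_infDist_pt _).measurable)
    ENNReal.ofReal_ne_top 3 volume_polycylinder_inter_ball_le

end Polycylinder

/-! ### The collected bounds -/

theorem mainTheorem2 :
    -- the value of the constant
    blichfeldtA2 = (29 - 16 * √2) / 6 ∧
    1 / blichfeldtA2 = 6 / (29 - 16 * √2) ∧
    (0.941533 : ℝ) < 1 / blichfeldtA2 ∧ 1 / blichfeldtA2 < 0.941534 ∧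
    ∀ n : ℕ,
      -- the gauge method applied to the capped bodies
      (∀ t : ℝ, 0 < t →
        IsBlichfeldtGauge (cappedBody n t) (cappedGauge n t) ∧
        MeasureTheory.Integrable (cappedGauge n t) ∧
        0 < gaugeMass (cappedGauge n t) ∧
        upperPackingDensity (cappedBody n t) ≤
          ENNReal.ofReal (MeasureTheory.volume.real (cappedBody n t) /
            gaugeMass (cappedGauge n t))) ∧
      ((fun t : ℝ => gaugeMass (cappedGauge n t) - Real.pi * blichfeldtA2 * t ^ n)
        =O[Filter.atTop] fun t : ℝ => t ^ ((n : ℤ) - 1)) ∧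
      (∃ R : ℝ → ℝ, (R =O[Filter.atTop] fun t : ℝ => t ^ ((n : ℤ) - 1)) ∧
        ∀ t : ℝ, 0 < t →
          0 < Real.pi * blichfeldtA2 * t ^ n + R t ∧
          upperPackingDensity (cappedBody n t) ≤
            ENNReal.ofReal (Real.pi * t ^ n / (Real.pi * blichfeldtA2 * t ^ n + R t))) ∧
      -- the resulting bound for polycylinders
      upperPackingDensity (polycylinder n) ≤ ENNReal.ofReal (1 / blichfeldtA2) := by
  refine ⟨blichfeldtA2_eq, by rw [blichfeldtA2_eq, one_div_div], one_div_blichfeldtA2_bounds.1,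
    one_div_blichfeldtA2_bounds.2, fun n => ⟨fun t ht => ⟨isBlichfeldtGauge_cappedGauge ht,
    integrable_cappedGauge ht, gaugeMass_cappedGauge_pos ht, upperPackingDensity_cappedBody_le ht⟩,
    gaugeMass_cappedGauge_isBigO n, exists_isBigO_upperPackingDensity_cappedBody_le n,
    upperPackingDensity_polycylinder_le n⟩⟩
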